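/- Let $A\in\mathbb{R}^{n\times n}$, $B\in\mathbb{R}^{n\times m}$ and let $C\in\mathbb{R}^{p\times n}$ have full row rank $p$. Consider $\dot x=Ax+Bu$, $y=Cx$. For a real square matrix $X$ let $\mathrm{eig}(X)$ be the multiset of its complex eigenvalues, counted with algebraic multiplicity. A pole set is a multiset $\Lambda=\{\lambda_1,\dots,\lambda_p\}$ of $p$ complex numbers that is invariant under complex conjugation. For $Z\in\mathbb{R}^{m\times p}$, say that the static output feedback $u(t)=-Zy(t)$ drives the output by placing the $p$ poles of a subsystem of order $p$ at $\Lambda$ if the following hold. There is $M\in\mathbb{R}^{p\times p}$ with $\mathrm{eig}(M)=\Lambda$ such that $\dot y(t)=My(t)$, $t\ge t_0$, along every closed-loop trajectory started at any time $t_0$ from any initial state. If $\mathrm{Re}\,\lambda_i<0$ for all $i$, then $y(t)\to 0$ as $t\to\infty$ along every closed-loop trajectory. For every $\alpha\in\mathbb{R}$ with $\mathrm{Re}\,\lambda_i<-\alpha$ for all $i$, there is a constant $K$ such that $\|y(t)\|\le Ke^{-\alpha(t-t_0)}\|y(t_0)\|$ for all $t\ge t_0$ along every closed-loop trajectory. (1)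 The following are equivalent. (i) Static output feedback can drive $y(t)\to 0$ at an arbitrary rate by placing the $p$ poles of a subsystem of order $p$ at any desired $\Lambda$. That is, for every pole set $\Lambda$ there is $Z\in\mathbb{R}^{m\times p}$ such that $u=-Zy$ drives the output by placing the poles at $\Lambda$. Moreover, for every $\alpha>0$ there are $Z$ and a pole set $\Lambda$ such that $u=-Zy$ drives the output by placing the poles at $\Lambda$ and such that, along every closed-loop trajectory, $y(t)\to 0$ and $\|y(t)\|\le Ke^{-\alpha(t-t_0)}\|y(t_0)\|$ for all $t\ge t_0$, with $K$ independent of the trajectory. (ii) $\mathrm{rank}\begin{pmatrix}CA\\ C\end{pmatrix}=\mathrm{rank}(C)$, and $\mathrm{rank}\begin{pmatrix}sC-CA & CB\end{pmatrix}=\mathrm{rank}(C)=p$ for all $s\in\mathbb{C}$. (2) Suppose that (ii) holds. Let $C^-$ be any generalised inverse of $C$ (that is, $CC^-C=C$) and let $\Lambda$ be any pole set. Then there is $Z\in\mathbb{R}^{m\times p}$ with $\mathrm{eig}(CAC^--CBZ)=\Lambda$. A gain $Z\in\mathbb{R}^{m\times p}$ drives the output by placing the $p$ poles of a subsystem of order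 $p$ at $\Lambda$ if and only if $\mathrm{eig}(CAC^--CBZ)=\Lambda$. For every such $Z$, $\Lambda$ is contained, with multiplicities, in $\mathrm{eig}(A-BZC)$. -/

import Mathlib

open Matrix

/-- The eigenvalues in `ℂ` of a real square matrix, each repeated according to its algebraic
multiplicity. -/
noncomputable def eig {k : ℕ} (M : Matrix (Fin k) (Fin k) ℝ) : Multiset ℂ :=
  (M.map (algebraMap ℝ ℂ)).charpoly.roots

/-- `Λ` is an admissible collection of `p` desired poles of a real system: `p` complex numbers,
repetitions allowed, invariant (with multiplicities) under complex conjugation. -/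
def IsPoleSet (p : ℕ) (Λ : Multiset ℂ) : Prop :=
  Multiset.card Λ = p ∧ Λ.map (starRingEnd ℂ) = Λ

/-- `x` solves `ẋ(t) = A x(t) + B u(t)` for `t ≥ t₀` (one-sided derivative at `t₀`). -/
def IsTrajectory {n m : ℕ} (A : Matrix (Fin n) (Fin n) ℝ) (B : Matrix (Fin n) (Fin m) ℝ)
    (t₀ : ℝ) (u : ℝ → Fin m → ℝ) (x : ℝ → Fin n → ℝ) : Prop :=
  ∀ t, t₀ ≤ t → HasDerivWithinAt x (A *ᵥ x t + B *ᵥ u t) (Set.Ici t₀) t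

/-- `x` is a trajectory from time `t₀` of `ẋ = A x + B u`, `y = C x` under the static output
feedback law `u(t) = -Z y(t)`. -/
def IsFeedbackTrajectory {n m p : ℕ} (A : Matrix (Fin n) (Fin n) ℝ)
    (B : Matrix (Fin n) (Fin m) ℝ) (C : Matrix (Fin p) (Fin n) ℝ)
    (Z : Matrix (Fin m) (Fin p) ℝ) (t₀ : ℝ) (x : ℝ → Fin n → ℝ) : Prop :=
  IsTrajectory A B t₀ (fun t => -(Z *ᵥ (C *ᵥ x t))) x

/-- Under `u = -Z y`, the output `y = C x` is governed by a subsystem of order `p`, namely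
`ẏ(t) = M y(t)` along every trajectory, whose `p` poles are placed at `Λ`. -/
def PlacesSubsystemPoles {n m p : ℕ} (A : Matrix (Fin n) (Fin n) ℝ)
    (B : Matrix (Fin n) (Fin m) ℝ) (C : Matrix (Fin p) (Fin n) ℝ)
    (Z : Matrix (Fin m) (Fin p) ℝ) (Λ : Multiset ℂ) : Prop :=
  ∃ M : Matrix (Fin p) (Fin p) ℝ,
    (∀ (t₀ : ℝ) (x : ℝ → Fin n → ℝ), IsFeedbackTrajectory A B C Z t₀ x →
      ∀ t, t₀ ≤ t →
        HasDerivWithinAt (fun τ => C *ᵥ x τ) (M *ᵥ (C *ᵥ x t)) (Set.Ici t₀) t) ∧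
    eig M = Λ

/-- Under `u = -Z y`, every output decays from any initial condition with exponential rate `α`:
`‖y(t)‖ ≤ K e^{-α (t - t₀)} ‖y(t₀)‖`, with one constant `K` for all trajectories. -/
def OutputDecaysAtRate {n m p : ℕ} (A : Matrix (Fin n) (Fin n) ℝ)
    (B : Matrix (Fin n) (Fin m) ℝ) (C : Matrix (Fin p) (Fin n) ℝ)
    (Z : Matrix (Fin m) (Fin p) ℝ) (α : ℝ) : Prop :=
  ∃ K : ℝ, ∀ (t₀ : ℝ) (x : ℝ → Fin n → ℝ), IsFeedbackTrajectory A B C Z t₀ x →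
    ∀ t, t₀ ≤ t → ‖C *ᵥ x t‖ ≤ K * Real.exp (-α * (t - t₀)) * ‖C *ᵥ x t₀‖

/-- Under `u = -Z y`, every output tends to zero. -/
def OutputTendsToZero {n m p : ℕ} (A : Matrix (Fin n) (Fin n) ℝ)
    (B : Matrix (Fin n) (Fin m) ℝ) (C : Matrix (Fin p) (Fin n) ℝ)
    (Z : Matrix (Fin m) (Fin p) ℝ) : Prop :=
  ∀ (t₀ : ℝ) (x : ℝ → Fin n → ℝ), IsFeedbackTrajectory A B C Z t₀ x →
    Filter.Tendsto (fun t => C *ᵥ x t) Filter.atTop (nhds 0)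

/-- The law `u = -Z y` drives the output by placing the `p` poles of a subsystem of order `p` at
`Λ`: the poles are placed, the output tends to zero if they lie in the open left half plane, and
it decays at every exponential rate `α` for which they lie to the left of `-α`. -/
def DrivesOutputByPlacing {n m p : ℕ} (A : Matrix (Fin n) (Fin n) ℝ)
    (B : Matrix (Fin n) (Fin m) ℝ) (C : Matrix (Fin p) (Fin n) ℝ)
    (Z : Matrix (Fin m) (Fin p) ℝ) (Λ : Multiset ℂ) : Prop :=
  PlacesSubsystemPoles A B C Z Λ ∧
  ((∀ z ∈ Λ, z.re < 0) → OutputTendsToZero A B C Z) ∧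
  (∀ α : ℝ, (∀ z ∈ Λ, z.re < -α) → OutputDecaysAtRate A B C Z α)

/-- Static output feedback can drive `y(t) → 0` at an arbitrary rate of convergence from any
initial condition by placing the `p` poles of a subsystem of order `p` at any desired `Λ`. -/
def CanDriveOutputByPlacement {n m p : ℕ} (A : Matrix (Fin n) (Fin n) ℝ)
    (B : Matrix (Fin n) (Fin m) ℝ) (C : Matrix (Fin p) (Fin n) ℝ) : Prop :=
  (∀ Λ : Multiset ℂ, IsPoleSet p Λ →
    ∃ Z : Matrix (Fin m) (Fin p) ℝ, DrivesOutputByPlacing A B C Z Λ) ∧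
  (∀ α : ℝ, 0 < α → ∃ Z : Matrix (Fin m) (Fin p) ℝ, ∃ Λ : Multiset ℂ, IsPoleSet p Λ ∧
    DrivesOutputByPlacing A B C Z Λ ∧ OutputTendsToZero A B C Z ∧ OutputDecaysAtRate A B C Z α)

/-- `rank [CA; C] = rank C`. -/
def OutputRankCondition {n p : ℕ} (A : Matrix (Fin n) (Fin n) ℝ) (C : Matrix (Fin p) (Fin n) ℝ) :
    Prop :=
  (Matrix.fromRows (C * A) C).rank = C.rank

/-- `rank [sC - CA, CB] = rank C = p` for every complex number `s`. -/
def PencilRankCondition {n m p : ℕ} (A : Matrix (Fin n) (Fin n) ℝ)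
    (B : Matrix (Fin n) (Fin m) ℝ) (C : Matrix (Fin p) (Fin n) ℝ) : Prop :=
  C.rank = p ∧ ∀ s : ℂ,
    (Matrix.fromCols
      (s • C.map (algebraMap ℝ ℂ) - (C * A).map (algebraMap ℝ ℂ))
      ((C * B).map (algebraMap ℝ ℂ))).rank = p

/-!
Since `C` has full row rank, the output obeys an autonomous equation `ẏ = M y` under `u = -Z y`
exactly when `C (A - B Z C) = M C` (`output_ode_iff`). Cancelling `C`, this means that
`C A = F C` for some `F`, necessarily `F = C A C⁻` for every generalised inverse `C⁻`, and
that `M = F - C B Z`. The existence of `F` is the condition `rank [CA; C] = rank C`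
(`outputRankCondition_iff`). The question thus becomes pole placement by state feedback for the pair
`(F, C B)`, and `rank [sC - CA, CB] = p` is the Hautus test for this pair
(`pencilRankCondition_iff`).

If the test fails at `s`, a left eigenvector of `F` for `s` annihilated by `C B` keeps `s` in the
spectrum of `F - C B Z` for every `Z`, so that a pole set avoiding `s` cannot be placed. If it holds,
the pair is controllable (`eq_top_of_hautus`); Heymann's lemma
(`exists_linearIndependent_iterate`) reduces to a single input, for which Ackermann's formula gives
the gain (`exists_charpoly_sub_smulRight_eq`).

The decay of `y` follows from `ẏ = M y` by writing the characteristic polynomial of `M` as a product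
of linear factors and solving one scalar equation per factor (`exists_decay_of_eig`). Finally
`M` is the map induced by `A - B Z C` on the quotient by the kernel of `C`, so its characteristic
polynomial divides that of `A - B Z C` (`charpoly_dvd_of_mul_eq`).
-/

/-! ### Pole placement over a field -/

/-- Single-input pole placement: if `b` is a cyclic vector of `f`, a rank-one feedback gives
`f - b k` any monic characteristic polynomial of the right degree. The gain is Ackermann's
`k = c ∘ q(f)`, where `c` is the functional dual to the last vector of the basis `fⁱ b`. -/
theorem exists_charpoly_sub_smulRight_eq {K V : Type*} [Field K] [AddCommGroup V] [Module K V]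
    [FiniteDimensional K V] (f : V →ₗ[K] V) (b : V)
    (hb : LinearIndependent K fun i : Fin (Module.finrank K V) => (f ^ (i : ℕ)) b)
    (q : Polynomial K) (hq : q.Monic) (hdeg : q.natDegree = Module.finrank K V) :
    ∃ k : V →ₗ[K] K, (f - k.smulRight b).charpoly = q := by
  set d := Module.finrank K V with hd
  -- The zero space is separate because `d - 1` truncates there.
  rcases Nat.eq_zero_or_pos d with h0 | hpos
  · refine ⟨0, ?_⟩
    rw [hq.natDegree_eq_zero.mp (hdeg.trans h0)]
    apply (LinearMap.charpoly_monic _).natDegree_eq_zero.mp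
    rw [LinearMap.charpoly_natDegree, ← hd, h0]
  have : Nonempty (Fin d) := ⟨⟨0, hpos⟩⟩
  let e := basisOfLinearIndependentOfCardEqFinrank hb (by simp [hd])
  let c : V →ₗ[K] K := e.coord ⟨d - 1, by omega⟩
  have hc : ∀ i, i < d → c ((f ^ i) b) = if i = d - 1 then 1 else 0 := by
    intro i hi
    have : (f ^ i) b = e ⟨i, hi⟩ := by simp [e]
    rw [this, Module.Basis.coord_apply, e.repr_self, Finsupp.single_apply]
    simp [Fin.ext_iff]
  -- The functional `g ↦ c (g(f) b)` reads off the coefficient of `X ^ (d - 1)`. Hence `c ∘ r(f) ≠ 0`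
  -- for a nonzero `r` of degree below `d`: the value at `r * X ^ (d - 1 - deg r)` is the leading
  -- coefficient of `r`.
  have hcp : ∀ g : Polynomial K, g.natDegree < d →
      c (Polynomial.aeval f g b) = g.coeff (d - 1) := by
    intro g hg
    rw [Polynomial.aeval_eq_sum_range' hg, LinearMap.sum_apply, map_sum,
      Finset.sum_eq_single (d - 1)]
    · simp [hc (d - 1) (by omega)]
    · intro i hi hne
      simp [hc i (Finset.mem_range.mp hi), hne]
    · intro h
      exact absurd (Finset.mem_range.mpr (by omega)) h
  let k : V →ₗ[K] K := c ∘ₗ Polynomial.aeval f q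
  let f' := f - k.smulRight b
  -- As `c (fⁱ b) = 0` for `i < d - 1`, the feedback is invisible to `c` in powers below `d`.
  have hpow : ∀ i, i < d → c ∘ₗ (f' ^ i) = c ∘ₗ (f ^ i) := by
    intro i
    induction i with
    | zero => simp
    | succ i ih =>
      intro hi
      ext v
      have h1 := LinearMap.congr_fun (ih (by omega)) (f' v)
      simp only [LinearMap.comp_apply] at h1 ⊢
      rw [pow_succ, Module.End.mul_apply, h1]
      simp [f', hc i (by omega), show i ≠ d - 1 by omega, pow_succ]
  have hpoly : ∀ g : Polynomial K, g.natDegree < d →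
      c ∘ₗ Polynomial.aeval f' g = c ∘ₗ Polynomial.aeval f g := by
    intro g hg
    rw [Polynomial.aeval_eq_sum_range' hg, Polynomial.aeval_eq_sum_range' hg]
    ext v
    simp only [LinearMap.comp_apply, LinearMap.sum_apply, map_sum, LinearMap.smul_apply, map_smul]
    refine Finset.sum_congr rfl fun i hi => ?_
    have := LinearMap.congr_fun (hpow i (Finset.mem_range.mp hi)) v
    simp only [LinearMap.comp_apply] at this
    rw [this]
  have hdiv : q.divX.natDegree < d := by rw [Polynomial.natDegree_divX_eq_natDegree_tsub_one]; omega
  have hlead : q.divX.coeff (d - 1) = 1 := by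
    rw [Polynomial.coeff_divX, show d - 1 + 1 = q.natDegree by omega]
    exact hq
  -- In degree `d` the feedback appears exactly once, and the choice of `k` cancels `c ∘ q(f)`.
  have hq0 : c ∘ₗ Polynomial.aeval f' q = 0 := by
    ext v
    have h1 := LinearMap.congr_fun (hpoly _ hdiv) (f' v)
    have h2 := hcp _ hdiv
    rw [hlead] at h2
    have hk : k v = c (Polynomial.aeval f q v) := rfl
    have h3 : ∀ (g : V →ₗ[K] V) v, Polynomial.aeval g q v =
        Polynomial.aeval g q.divX (g v) + q.coeff 0 • v := by
      intro g v
      conv_lhs => rw [← Polynomial.divX_mul_X_add q]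
      simp
    simp only [LinearMap.comp_apply] at h1 ⊢
    rw [h3, map_add, h1]
    rw [h3, map_add] at hk
    simp only [f', LinearMap.sub_apply, map_sub, LinearMap.smulRight_apply, map_smul, h2, hk,
      LinearMap.zero_apply, smul_eq_mul]
    ring
  refine ⟨k, ?_⟩
  change f'.charpoly = q
  by_contra hne
  -- Both `q` and the characteristic polynomial are monic and satisfy `c ∘ g(f') = 0`, so their
  -- difference has degree below `d` and must vanish.
  set r := f'.charpoly - q with hr
  have hr0 : r ≠ 0 := sub_ne_zero.mpr hne
  have hrd : r.natDegree < d := by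
    have hlt : r.degree < f'.charpoly.degree := by
      apply Polynomial.degree_sub_lt_left _ f'.charpoly_monic.ne_zero
      · rw [f'.charpoly_monic.leadingCoeff, hq.leadingCoeff]
      · rw [Polynomial.degree_eq_natDegree f'.charpoly_monic.ne_zero,
          Polynomial.degree_eq_natDegree hq.ne_zero, LinearMap.charpoly_natDegree, hdeg]
    have := Polynomial.natDegree_lt_natDegree hr0 hlt
    rwa [LinearMap.charpoly_natDegree] at this
  have hr1 : c ∘ₗ Polynomial.aeval f r = 0 := by
    rw [← hpoly r hrd, hr, map_sub, LinearMap.aeval_self_charpoly, LinearMap.comp_sub, hq0]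
    simp
  have hm : (r * Polynomial.X ^ (d - 1 - r.natDegree)).natDegree = d - 1 := by
    rw [Polynomial.natDegree_mul_X_pow _ hr0]; omega
  have := hcp (r * Polynomial.X ^ (d - 1 - r.natDegree)) (by omega)
  rw [map_mul, Module.End.mul_apply] at this
  have h4 := LinearMap.congr_fun hr1
    (Polynomial.aeval f (Polynomial.X ^ (d - 1 - r.natDegree) : Polynomial K) b)
  simp only [LinearMap.comp_apply] at h4
  rw [h4, LinearMap.zero_apply] at this
  rw [Polynomial.coeff_mul_X_pow', if_pos (by omega),
    show d - 1 - (d - 1 - r.natDegree) = r.natDegree by omega] at this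
  exact hr0 (Polynomial.leadingCoeff_eq_zero.mp this.symm)

/-- Heymann's lemma: if `⊤` is the only `f`-invariant subspace containing the range of `g`, then a
preliminary feedback `k` makes any nonzero `b` cyclic. The gain is built by induction on the
number `d` of independent iterates: when the `d`-th iterate falls into the span of the previous
ones, that span is invariant under `f + g k`, so it misses some `g u`, and `k` can be altered on
the last iterate alone so as to add `g u` to the `d`-th one. -/
theorem exists_linearIndependent_iterate {K V U : Type*} [Field K] [AddCommGroup V] [Module K V]
    [FiniteDimensional K V] [AddCommGroup U] [Module K U] (f : V →ₗ[K] V) (g : U →ₗ[K] V)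
    (hctr : ∀ W : Submodule K V, W ≤ W.comap f → LinearMap.range g ≤ W → W = ⊤)
    (b : V) (hb : b ≠ 0) (d : ℕ) (hd : d ≤ Module.finrank K V) :
    ∃ k : V →ₗ[K] U, LinearIndependent K fun i : Fin d => ((f + g ∘ₗ k) ^ (i : ℕ)) b := by
  induction d with
  | zero => exact ⟨0, linearIndependent_empty_type⟩
  | succ d ih =>
    obtain ⟨k, hk⟩ := ih (by omega)
    rcases Nat.eq_zero_or_pos d with rfl | hpos
    · refine ⟨0, ?_⟩
      change LinearIndependent K fun i : Fin 1 => _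
      rw [linearIndependent_unique_iff]
      simpa using hb
    set h := f + g ∘ₗ k with hh
    let W := Submodule.span K (Set.range fun i : Fin d => (h ^ (i : ℕ)) b)
    have hmem : ∀ i, i < d → (h ^ i) b ∈ W := fun i hi => Submodule.subset_span ⟨⟨i, hi⟩, rfl⟩
    have key : ∀ k' : V →ₗ[K] U, (∀ i, i < d → ((f + g ∘ₗ k') ^ i) b = (h ^ i) b) →
        ((f + g ∘ₗ k') ^ d) b ∉ W →
        LinearIndependent K fun i : Fin (d + 1) => ((f + g ∘ₗ k') ^ (i : ℕ)) b := by
      intro k' h1 h2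
      rw [linearIndependent_finSucc']
      have : (Fin.init fun i : Fin (d + 1) => ((f + g ∘ₗ k') ^ (i : ℕ)) b) =
          fun i : Fin d => (h ^ (i : ℕ)) b := by
        funext i
        simpa [Fin.init] using h1 i i.2
      rw [this]
      exact ⟨hk, by simpa using h2⟩
    by_cases hW : (h ^ d) b ∈ W
    · have hinv : W ≤ W.comap h := by
        rw [Submodule.span_le]
        rintro _ ⟨i, rfl⟩
        change h ((h ^ (i : ℕ)) b) ∈ W
        rw [← Module.End.mul_apply, ← pow_succ']
        rcases Nat.lt_or_ge (i + 1) d with hi | hi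
        · exact hmem _ hi
        · rwa [show (i : ℕ) + 1 = d by omega]
      have hne : W ≠ ⊤ := by
        intro htop
        have h1 := finrank_span_eq_card hk
        change Module.finrank K W = _ at h1
        rw [htop, finrank_top, Fintype.card_fin] at h1
        omega
      have hg : ¬ LinearMap.range g ≤ W := by
        intro hle
        refine hne (hctr W (fun v hv => ?_) hle)
        have h1 : h v - g (k v) ∈ W := W.sub_mem (hinv hv) (hle ⟨k v, rfl⟩)
        simpa [hh] using h1
      obtain ⟨_, ⟨u, rfl⟩, hu⟩ := Set.not_subset.mp hg
      obtain ⟨φ, hφ⟩ : ∃ φ : V →ₗ[K] K, ∀ i : Fin d, φ ((h ^ (i : ℕ)) b) =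
          if (i : ℕ) = d - 1 then 1 else 0 := by
        obtain ⟨φ, hφ⟩ := LinearMap.exists_extend
          ((Module.Basis.span hk).constr K fun i : Fin d => if (i : ℕ) = d - 1 then (1 : K) else 0)
        refine ⟨φ, fun i => ?_⟩
        have h1 := LinearMap.congr_fun hφ (Module.Basis.span hk i)
        rw [Module.Basis.constr_basis] at h1
        rw [← h1, LinearMap.comp_apply, Submodule.subtype_apply, Module.Basis.span_apply]
      let k' := k + φ.smulRight u
      have hk' : ∀ v, (f + g ∘ₗ k') v = h v + φ v • g u := by
        intro v
        simp [k', hh, add_assoc]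
      have hpow : ∀ i, i < d → ((f + g ∘ₗ k') ^ i) b = (h ^ i) b := by
        intro i
        induction i with
        | zero => simp
        | succ i ih =>
          intro hi
          rw [pow_succ', Module.End.mul_apply, ih (by omega), hk', hφ ⟨i, by omega⟩,
            if_neg (by simp; omega), zero_smul, add_zero, pow_succ', Module.End.mul_apply]
      refine ⟨k', key k' hpow ?_⟩
      obtain ⟨j, rfl⟩ : ∃ j, d = j + 1 := ⟨d - 1, by omega⟩
      rw [pow_succ', Module.End.mul_apply, hpow j (by omega), hk', hφ ⟨j, by omega⟩,
        if_pos (by simp), one_smul, ← Module.End.mul_apply, ← pow_succ']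
      intro hc
      exact hu ((W.add_mem_iff_right hW).mp hc)
    · exact ⟨k, key k (fun _ _ => rfl) hW⟩

/-- Multi-input pole placement over an arbitrary field, in terms of characteristic polynomials. -/
theorem exists_charpoly_sub_comp_eq {K V U : Type*} [Field K] [AddCommGroup V] [Module K V]
    [FiniteDimensional K V] [AddCommGroup U] [Module K U] (f : V →ₗ[K] V) (g : U →ₗ[K] V)
    (hctr : ∀ W : Submodule K V, W ≤ W.comap f → LinearMap.range g ≤ W → W = ⊤)
    (q : Polynomial K) (hq : q.Monic) (hdeg : q.natDegree = Module.finrank K V) :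
    ∃ k : V →ₗ[K] U, (f - g ∘ₗ k).charpoly = q := by
  rcases Nat.eq_zero_or_pos (Module.finrank K V) with h0 | hpos
  · refine ⟨0, ?_⟩
    rw [hq.natDegree_eq_zero.mp (hdeg.trans h0)]
    apply (LinearMap.charpoly_monic _).natDegree_eq_zero.mp
    rw [LinearMap.charpoly_natDegree, h0]
  obtain ⟨u, hu⟩ : ∃ u, g u ≠ 0 := by
    by_contra! hz
    have h1 := hctr ⊥ (by simp) (by rintro _ ⟨u, rfl⟩; simp [hz u])
    have := finrank_bot K V
    rw [h1, finrank_top] at this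
    omega
  obtain ⟨k₁, hk₁⟩ := exists_linearIndependent_iterate f g hctr (g u) hu _ le_rfl
  obtain ⟨k₂, hk₂⟩ := exists_charpoly_sub_smulRight_eq _ _ hk₁ q hq hdeg
  refine ⟨k₂.smulRight u - k₁, ?_⟩
  rw [← hk₂]
  congr 1
  ext v
  simp
  abel

/-! ### Rank conditions -/

/-- Full row rank means that no nonzero row vector is annihilated. -/
theorem rank_eq_card_rows_iff {K : Type*} [Field K] {p : ℕ} {ι : Type*} [Fintype ι]
    (N : Matrix (Fin p) ι K) : N.rank = p ↔ ∀ w : Fin p → K, w ᵥ* N = 0 → w = 0 := by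
  rw [Matrix.rank_eq_finrank_span_row]
  have h := linearIndependent_iff_card_eq_finrank_span (R := K) (b := N.row)
  rw [Fintype.card_fin] at h
  constructor
  · intro hr w hw
    have h1 := Matrix.vecMul_injective_iff.mpr (h.mpr hr.symm)
    exact h1 (by simpa using hw)
  · intro hw
    refine (h.mp (Matrix.vecMul_injective_iff.mp ?_)).symm
    intro a b hab
    exact sub_eq_zero.mp (hw _ (by rw [Matrix.sub_vecMul, sub_eq_zero]; exact hab))

theorem eq_of_mul_right_eq {K : Type*} [Field K] {p n k : ℕ} {C : Matrix (Fin p) (Fin n) K}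
    (hC : C.rank = p) {X Y : Matrix (Fin k) (Fin p) K} (h : X * C = Y * C) : X = Y := by
  ext i j
  have h1 : (X i - Y i) ᵥ* C = 0 := by
    rw [Matrix.sub_vecMul, sub_eq_zero]
    exact congrFun h i
  exact congrFun (sub_eq_zero.mp ((rank_eq_card_rows_iff C).mp hC _ h1)) j

theorem exists_mul_eq_one {K : Type*} [Field K] {p n : ℕ} {C : Matrix (Fin p) (Fin n) K}
    (hC : C.rank = p) : ∃ D : Matrix (Fin n) (Fin p) K, C * D = 1 := by
  rw [← Matrix.mulVec_surjective_iff_exists_right_inverse, ← Matrix.coe_mulVecLin,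
    ← LinearMap.range_eq_top]
  apply Submodule.eq_top_of_finrank_eq
  change C.rank = _
  simp [hC]

/-- The rank condition `rank [CA; C] = rank C` says that the kernel of `C` is `A`-invariant, that
is, that `A` induces a map `F` on outputs. -/
theorem outputRankCondition_iff {n p : ℕ} (A : Matrix (Fin n) (Fin n) ℝ)
    (C : Matrix (Fin p) (Fin n) ℝ) (hC : C.rank = p) :
    OutputRankCondition A C ↔ ∃ F : Matrix (Fin p) (Fin p) ℝ, C * A = F * C := by
  unfold OutputRankCondition
  constructor
  · intro h
    obtain ⟨D, hD⟩ := exists_mul_eq_one hC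
    have hle : LinearMap.ker (Matrix.fromRows (C * A) C).mulVecLin ≤ LinearMap.ker C.mulVecLin := by
      intro v hv
      rw [LinearMap.mem_ker, Matrix.mulVecLin_apply, Matrix.fromRows_mulVec] at hv
      rw [LinearMap.mem_ker, Matrix.mulVecLin_apply]
      funext i
      exact congrFun hv (Sum.inr i)
    have h1 := LinearMap.finrank_range_add_finrank_ker (Matrix.fromRows (C * A) C).mulVecLin
    have h2 := LinearMap.finrank_range_add_finrank_ker C.mulVecLin
    change (Matrix.fromRows (C * A) C).rank + _ = _ at h1
    change C.rank + _ = _ at h2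
    have heq := Submodule.eq_of_le_of_finrank_eq hle (by omega)
    refine ⟨C * A * D, ?_⟩
    apply Matrix.ext_of_mulVec_single
    intro j
    have hv : (Pi.single j 1 - (D * C) *ᵥ Pi.single j 1) ∈ LinearMap.ker C.mulVecLin := by
      rw [LinearMap.mem_ker, Matrix.mulVecLin_apply, Matrix.mulVec_sub, Matrix.mulVec_mulVec,
        ← Matrix.mul_assoc, hD, Matrix.one_mul, sub_self]
    rw [← heq, LinearMap.mem_ker, Matrix.mulVecLin_apply, Matrix.fromRows_mulVec] at hv
    have hv' : (C * A) *ᵥ (Pi.single j 1 - (D * C) *ᵥ Pi.single j 1) = 0 := by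
      funext i
      exact congrFun hv (Sum.inl i)
    rw [Matrix.mulVec_sub, sub_eq_zero, Matrix.mulVec_mulVec] at hv'
    rw [hv', Matrix.mul_assoc (C * A)]
  · rintro ⟨F, hF⟩
    apply le_antisymm
    · have : Matrix.fromRows (C * A) C = Matrix.fromRows F 1 * C := by
        rw [Matrix.fromRows_mul, hF, Matrix.one_mul]
      rw [this]
      exact Matrix.rank_mul_le_right _ _
    · have : C = Matrix.fromCols (0 : Matrix (Fin p) (Fin p) ℝ) (1 : Matrix (Fin p) (Fin p) ℝ) *
          Matrix.fromRows (C * A) C := by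
        rw [Matrix.fromCols_mul_fromRows]; simp
      conv_lhs => rw [this]
      exact Matrix.rank_mul_le_right _ _

/-- Once `C A = F C`, the pencil condition is the Hautus test for the pair `(F, C B)`: no left
eigenvector of `F` is annihilated by `C B`. -/
theorem pencilRankCondition_iff {n m p : ℕ} (A : Matrix (Fin n) (Fin n) ℝ)
    (B : Matrix (Fin n) (Fin m) ℝ) (C : Matrix (Fin p) (Fin n) ℝ) (hC : C.rank = p)
    (F : Matrix (Fin p) (Fin p) ℝ) (hF : C * A = F * C) :
    PencilRankCondition A B C ↔ ∀ (s : ℂ) (w : Fin p → ℂ),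
      w ᵥ* F.map (algebraMap ℝ ℂ) = s • w → w ᵥ* (C * B).map (algebraMap ℝ ℂ) = 0 → w = 0 := by
  unfold PencilRankCondition
  simp only [hC, true_and]
  refine forall_congr' fun s => ?_
  rw [rank_eq_card_rows_iff]
  refine forall_congr' fun w => ?_
  obtain ⟨D, hD⟩ := exists_mul_eq_one hC
  have hDc : C.map (algebraMap ℝ ℂ) * D.map (algebraMap ℝ ℂ) = 1 := by
    rw [← Matrix.map_mul, hD, Matrix.map_one _ (map_zero _) (map_one _)]
  have h1 : w ᵥ* (s • C.map (algebraMap ℝ ℂ) - (C * A).map (algebraMap ℝ ℂ)) =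
      (s • w - w ᵥ* F.map (algebraMap ℝ ℂ)) ᵥ* C.map (algebraMap ℝ ℂ) := by
    rw [hF, Matrix.map_mul, Matrix.vecMul_sub, Matrix.sub_vecMul, Matrix.vecMul_smul,
      Matrix.smul_vecMul, Matrix.vecMul_vecMul]
  have h2 : w ᵥ* (s • C.map (algebraMap ℝ ℂ) - (C * A).map (algebraMap ℝ ℂ)) = 0 ↔
      w ᵥ* F.map (algebraMap ℝ ℂ) = s • w := by
    rw [h1]
    constructor
    · intro h
      have := congrArg (· ᵥ* D.map (algebraMap ℝ ℂ)) h
      simp only [Matrix.vecMul_vecMul, hDc, Matrix.vecMul_one, Matrix.zero_vecMul] at this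
      exact (sub_eq_zero.mp this).symm
    · intro h
      rw [h, sub_self, Matrix.zero_vecMul]
  rw [Matrix.vecMul_fromCols, ← h2]
  constructor
  · intro h h3 h4
    exact h (by rw [h3, h4]; funext i; cases i <;> rfl)
  · intro h h3
    exact h (funext fun i => congrFun h3 (Sum.inl i)) (funext fun i => congrFun h3 (Sum.inr i))

/-- The Hautus test over `ℂ` forces controllability over `ℝ`: the complex functionals vanishing on
a proper invariant subspace form a nonzero space stable under the transpose of `F`, which
therefore contains an eigenvector. -/
theorem eq_top_of_hautus {p m : ℕ} (F : Matrix (Fin p) (Fin p) ℝ) (G : Matrix (Fin p) (Fin m) ℝ)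
    (h : ∀ (s : ℂ) (w : Fin p → ℂ), w ᵥ* F.map (algebraMap ℝ ℂ) = s • w →
      w ᵥ* G.map (algebraMap ℝ ℂ) = 0 → w = 0)
    (W : Submodule ℝ (Fin p → ℝ)) (hF : W ≤ W.comap F.mulVecLin)
    (hG : LinearMap.range G.mulVecLin ≤ W) : W = ⊤ := by
  by_contra hne
  let N : Submodule ℂ (Fin p → ℂ) :=
    { carrier := {w | ∀ v ∈ W, w ⬝ᵥ (fun i => (v i : ℂ)) = 0}
      add_mem' := fun {a b} ha hb v hv => by rw [add_dotProduct, ha v hv, hb v hv, add_zero]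
      zero_mem' := fun v _ => zero_dotProduct _
      smul_mem' := fun c a ha v hv => by rw [smul_dotProduct, ha v hv, smul_zero] }
  have hmv : ∀ {k : ℕ} (H : Matrix (Fin p) (Fin k) ℝ) (w : Fin p → ℂ) (v : Fin k → ℝ),
      (w ᵥ* H.map (algebraMap ℝ ℂ)) ⬝ᵥ (fun i => (v i : ℂ)) =
        w ⬝ᵥ (fun i => ((H *ᵥ v) i : ℂ)) := by
    intro k H w v
    rw [← Matrix.dotProduct_mulVec]
    congr 1
    funext i
    simp [Matrix.mulVec, dotProduct]
  have hinv : ∀ w ∈ N, (F.map (algebraMap ℝ ℂ)).vecMulLinear w ∈ N := by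
    intro w hw v hv
    rw [Matrix.vecMulLinear_apply, hmv]
    exact hw _ (hF hv)
  have hNT : Nontrivial N := by
    obtain ⟨φ, hφ0, hφ⟩ := Submodule.exists_le_ker_of_lt_top W (lt_top_iff_ne_top.mpr hne)
    have hsum : ∀ v, φ v = ∑ i, φ (Pi.single i 1) * v i := by
      intro v
      conv_lhs => rw [pi_eq_sum_univ' v]
      simp [mul_comm]
    rw [Submodule.nontrivial_iff_ne_bot, Submodule.ne_bot_iff]
    refine ⟨fun i => (φ (Pi.single i 1) : ℂ), fun v hv => ?_, fun h0 => hφ0 ?_⟩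
    · have h1 : φ v = 0 := hφ hv
      rw [hsum] at h1
      simp only [dotProduct]
      exact_mod_cast h1
    · ext i
      simpa using congrFun h0 i
  obtain ⟨s, hs⟩ := Module.End.exists_eigenvalue
    ((F.map (algebraMap ℝ ℂ)).vecMulLinear.restrict hinv)
  obtain ⟨w, hw⟩ := hs.exists_hasEigenvector
  refine hw.2 (Subtype.ext (h s w ?_ ?_))
  · exact congrArg Subtype.val hw.apply_eq_smul
  · funext j
    have h1 := hmv G w (Pi.single j 1)
    have h2 : (w : Fin p → ℂ) ⬝ᵥ (fun i => ((G *ᵥ Pi.single j 1) i : ℂ)) = 0 := w.2 _ (hG ⟨_, rfl⟩)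
    rw [h2] at h1
    have : (fun i => ((Pi.single j 1 : Fin m → ℝ) i : ℂ)) = Pi.single j 1 := by
      funext i
      by_cases hij : i = j
      · subst hij; simp
      · simp [hij]
    rwa [this, dotProduct_single_one] at h1

/-! ### Pole placement for real matrices -/

/-- A pole set is the root multiset of a real monic polynomial. -/
theorem exists_real_poly {p : ℕ} {Λ : Multiset ℂ} (hΛ : IsPoleSet p Λ) :
    ∃ q : Polynomial ℝ, q.Monic ∧ q.natDegree = p ∧ (q.map (algebraMap ℝ ℂ)).roots = Λ := by
  set P : Polynomial ℂ := (Λ.map fun z => Polynomial.X - Polynomial.C z).prod with hP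
  have hPm : P.Monic := Polynomial.monic_multisetProd_X_sub_C Λ
  have hlift : P ∈ Polynomial.lifts (algebraMap ℝ ℂ) := by
    rw [Polynomial.lifts_iff_coeff_lifts]
    intro i
    have h1 : P.map (starRingEnd ℂ) = P := by
      rw [hP, Polynomial.map_multiset_prod, Multiset.map_map]
      conv_rhs => rw [← hΛ.2, Multiset.map_map]
      simp
    have h2 := congrArg (Polynomial.coeff · i) h1
    simp only [Polynomial.coeff_map] at h2
    exact ⟨_, Complex.conj_eq_iff_re.mp h2⟩
  obtain ⟨q, hq, hd, hqm⟩ := Polynomial.lifts_and_natDegree_eq_and_monic hlift hPm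
  refine ⟨q, hqm, ?_, ?_⟩
  · rw [hd, hP, Polynomial.natDegree_multiset_prod_X_sub_C_eq_card, hΛ.1]
  · rw [hq, hP, Polynomial.roots_multiset_prod_X_sub_C]

/-- Pole placement for real matrices satisfying the Hautus test. -/
theorem exists_eig_sub_mul_eq {p m : ℕ} (F : Matrix (Fin p) (Fin p) ℝ)
    (G : Matrix (Fin p) (Fin m) ℝ)
    (h : ∀ (s : ℂ) (w : Fin p → ℂ), w ᵥ* F.map (algebraMap ℝ ℂ) = s • w →
      w ᵥ* G.map (algebraMap ℝ ℂ) = 0 → w = 0)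
    {Λ : Multiset ℂ} (hΛ : IsPoleSet p Λ) :
    ∃ Z : Matrix (Fin m) (Fin p) ℝ, eig (F - G * Z) = Λ := by
  obtain ⟨q, hqm, hqd, hqr⟩ := exists_real_poly hΛ
  obtain ⟨k, hk⟩ := exists_charpoly_sub_comp_eq F.mulVecLin G.mulVecLin (eq_top_of_hautus F G h) q
    hqm (by simpa using hqd)
  refine ⟨LinearMap.toMatrix' k, ?_⟩
  have : (F - G * LinearMap.toMatrix' k).charpoly = q := by
    rw [← hk, ← LinearMap.charpoly_toMatrix _ (Pi.basisFun ℝ (Fin p))]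
    congr 1
    rw [LinearMap.toMatrix_eq_toMatrix', map_sub, LinearMap.toMatrix'_comp]
    rw [← Matrix.toLin'_apply', ← Matrix.toLin'_apply', LinearMap.toMatrix'_toLin',
      LinearMap.toMatrix'_toLin']
  rw [eig, Matrix.charpoly_map, this, hqr]

/-! ### Characteristic polynomials of induced maps -/

/-- If `C A = M C` and `D` is a right inverse of `C`, then `N = A - D M C` satisfies `C N = 0`,
whence `(X - D M C) (X - N) = X (X - A)`. Taking determinants, and using that `D M C` and
`C D M = M` have the same characteristic polynomial up to powers of `X`, gives the divisibility up
to a power of `X`. -/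
theorem charpoly_dvd_X_pow_mul_of_mul_eq {R : Type*} [Field R] {n p : ℕ}
    (A : Matrix (Fin n) (Fin n) R) (C : Matrix (Fin p) (Fin n) R)
    (D : Matrix (Fin n) (Fin p) R) (M : Matrix (Fin p) (Fin p) R)
    (hD : C * D = 1) (hM : C * A = M * C) :
    M.charpoly ∣ Polynomial.X ^ p * A.charpoly := by
  set N := A - D * M * C with hN
  have hCN : C * N = 0 := by
    rw [hN, Matrix.mul_sub, hM, ← Matrix.mul_assoc, ← Matrix.mul_assoc, hD, Matrix.one_mul,
      sub_self]
  have key : (D * M * C).charmatrix * N.charmatrix =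
      (Polynomial.X : Polynomial R) • A.charmatrix := by
    have h1 : (D * M * C * N) = 0 := by rw [Matrix.mul_assoc, hCN, Matrix.mul_zero]
    have h2 := congrArg (fun Q => Q.map (Polynomial.C : R →+* Polynomial R)) h1
    simp only [Matrix.map_mul] at h2
    have h3 : A = N + D * M * C := by rw [hN]; abel
    rw [h3]
    simp only [Matrix.charmatrix, Matrix.sub_mul, Matrix.mul_sub, RingHom.mapMatrix_apply]
    rw [Matrix.map_mul, Matrix.map_mul, Matrix.map_add _ (map_add _), Matrix.map_mul,
      Matrix.map_mul, h2, smul_sub, smul_add]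
    simp only [Matrix.scalar_apply, ← Matrix.smul_one_eq_diagonal,
      Matrix.smul_mul, Matrix.one_mul, Matrix.mul_smul, Matrix.mul_one]
    simp
    abel
  have hdet := congrArg Matrix.det key
  rw [Matrix.det_mul, Matrix.det_smul, Fintype.card_fin] at hdet
  change (D * M * C).charpoly * N.charpoly = _ * A.charpoly at hdet
  have h5 := Matrix.charpoly_mul_comm' (D * M) C
  rw [← Matrix.mul_assoc, hD, Matrix.one_mul, Fintype.card_fin,
    Fintype.card_fin] at h5
  refine ⟨N.charpoly, ?_⟩
  have hX : (Polynomial.X : Polynomial R) ^ n ≠ 0 := pow_ne_zero _ Polynomial.X_ne_zero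
  apply mul_left_cancel₀ hX
  calc _ = Polynomial.X ^ p * ((D * M * C).charpoly * N.charpoly) := by rw [hdet]; ring
    _ = _ := by rw [← mul_assoc, h5, mul_assoc]

/-- The characteristic polynomial of the map `M` induced on a quotient divides that of `A`. The
power of `X` in `charpoly_dvd_X_pow_mul_of_mul_eq` becomes a power of `X - c` after shifting `A`
and `M` by `c`, and is coprime to the characteristic polynomial of `M` when `c` is not a root. -/
theorem charpoly_dvd_of_mul_eq {R : Type*} [Field R] [Infinite R] {n p : ℕ}
    {A : Matrix (Fin n) (Fin n) R} {C : Matrix (Fin p) (Fin n) R} (hC : C.rank = p)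
    {M : Matrix (Fin p) (Fin p) R} (hM : C * A = M * C) : M.charpoly ∣ A.charpoly := by
  classical
  obtain ⟨D, hD⟩ := exists_mul_eq_one hC
  obtain ⟨c, hc⟩ := Infinite.exists_notMem_finset M.charpoly.roots.toFinset
  have hc' : ¬ M.charpoly.IsRoot c := fun h => hc (by
    rw [Multiset.mem_toFinset, Polynomial.mem_roots M.charpoly_monic.ne_zero]; exact h)
  have h1 := charpoly_dvd_X_pow_mul_of_mul_eq (A - Matrix.scalar _ c) C D
    (M - Matrix.scalar _ c) hD (by
      rw [Matrix.mul_sub, Matrix.sub_mul, hM, Matrix.scalar_apply, Matrix.scalar_apply,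
        ← Matrix.smul_one_eq_diagonal, ← Matrix.smul_one_eq_diagonal, Matrix.mul_smul,
        Matrix.smul_mul, Matrix.mul_one, Matrix.one_mul])
  rw [Matrix.charpoly_sub_scalar, Matrix.charpoly_sub_scalar] at h1
  have h2 := map_dvd (Polynomial.compRingHom (Polynomial.X - Polynomial.C c)) h1
  simp only [Polynomial.coe_compRingHom_apply, Polynomial.mul_comp, Polynomial.comp_assoc,
    Polynomial.pow_comp, Polynomial.add_comp, Polynomial.X_comp, Polynomial.C_comp,
    sub_add_cancel, Polynomial.comp_X] at h2
  have hcop : IsCoprime M.charpoly ((Polynomial.X - Polynomial.C c) ^ p) := by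
    apply IsCoprime.pow_right
    apply IsCoprime.symm
    rw [(Polynomial.irreducible_X_sub_C c).coprime_iff_not_dvd, Polynomial.dvd_iff_isRoot]
    exact hc'
  exact hcop.dvd_of_dvd_mul_left h2

theorem eig_le_eig_of_mul_eq {n p : ℕ} {A : Matrix (Fin n) (Fin n) ℝ}
    {C : Matrix (Fin p) (Fin n) ℝ} (hC : C.rank = p)
    {M : Matrix (Fin p) (Fin p) ℝ} (hM : C * A = M * C) : eig M ≤ eig A := by
  unfold eig
  apply Polynomial.roots.le_of_dvd (Matrix.charpoly_monic _).ne_zero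
  rw [Matrix.charpoly_map, Matrix.charpoly_map]
  exact Polynomial.map_dvd _ (charpoly_dvd_of_mul_eq hC hM)

/-! ### Closed-loop trajectories and the output equation -/

theorem exists_feedbackTrajectory {n m p : ℕ} (A : Matrix (Fin n) (Fin n) ℝ)
    (B : Matrix (Fin n) (Fin m) ℝ) (C : Matrix (Fin p) (Fin n) ℝ)
    (Z : Matrix (Fin m) (Fin p) ℝ) (x₀ : Fin n → ℝ) :
    ∃ x : ℝ → Fin n → ℝ, IsFeedbackTrajectory A B C Z 0 x ∧ x 0 = x₀ := by
  let T : (Fin n → ℝ) →L[ℝ] (Fin n → ℝ) := LinearMap.toContinuousLinearMap (A - B * Z * C).mulVecLin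
  refine ⟨fun t => NormedSpace.exp (t • T) x₀, fun t _ => ?_, by simp⟩
  have h := (hasDerivAt_exp_smul_const' T t).clm_apply (hasDerivAt_const t x₀)
  refine h.hasDerivWithinAt.congr_deriv ?_
  simp [T, Matrix.mulVec_neg, sub_eq_add_neg]

theorem mulVec_hasDerivWithinAt {k n : ℕ} {𝕜 : Type*} [RCLike 𝕜] (C : Matrix (Fin k) (Fin n) 𝕜)
    {x : ℝ → Fin n → 𝕜} {x' : Fin n → 𝕜} {s : Set ℝ} {t : ℝ} (h : HasDerivWithinAt x x' s t) :
    HasDerivWithinAt (fun τ => C *ᵥ x τ) (C *ᵥ x') s t := by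
  have h1 := (((LinearMap.toContinuousLinearMap C.mulVecLin).restrictScalars ℝ).hasFDerivAt
    (x := x t)).comp_hasDerivWithinAt t h
  exact h1

theorem output_hasDerivWithinAt {n m p : ℕ} {A : Matrix (Fin n) (Fin n) ℝ}
    {B : Matrix (Fin n) (Fin m) ℝ} {C : Matrix (Fin p) (Fin n) ℝ}
    {Z : Matrix (Fin m) (Fin p) ℝ} {t₀ : ℝ} {x : ℝ → Fin n → ℝ}
    (hx : IsFeedbackTrajectory A B C Z t₀ x) {t : ℝ} (ht : t₀ ≤ t) :
    HasDerivWithinAt (fun τ => C *ᵥ x τ) ((C * (A - B * Z * C)) *ᵥ x t) (Set.Ici t₀) t := by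
  refine (mulVec_hasDerivWithinAt C (hx t ht)).congr_deriv ?_
  rw [← Matrix.mulVec_mulVec, Matrix.sub_mulVec, Matrix.mulVec_neg, ← sub_eq_add_neg,
    Matrix.mulVec_mulVec, Matrix.mulVec_mulVec, Matrix.mul_assoc]

/-- The output obeys `ẏ = M y` along all closed-loop trajectories exactly when `C` intertwines the
closed-loop matrix with `M`: the initial state is arbitrary, and one-sided derivatives are
unique. -/
theorem output_ode_iff {n m p : ℕ} (A : Matrix (Fin n) (Fin n) ℝ)
    (B : Matrix (Fin n) (Fin m) ℝ) (C : Matrix (Fin p) (Fin n) ℝ)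
    (Z : Matrix (Fin m) (Fin p) ℝ) (M : Matrix (Fin p) (Fin p) ℝ) :
    (∀ (t₀ : ℝ) (x : ℝ → Fin n → ℝ), IsFeedbackTrajectory A B C Z t₀ x →
      ∀ t, t₀ ≤ t →
        HasDerivWithinAt (fun τ => C *ᵥ x τ) (M *ᵥ (C *ᵥ x t)) (Set.Ici t₀) t) ↔
      C * (A - B * Z * C) = M * C := by
  constructor
  · intro h
    apply Matrix.ext_of_mulVec_single
    intro j
    obtain ⟨x, hx, hx0⟩ := exists_feedbackTrajectory A B C Z (Pi.single j 1)
    have h1 := h 0 x hx 0 le_rfl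
    have h2 := output_hasDerivWithinAt hx le_rfl
    have := (uniqueDiffOn_Ici (0 : ℝ) 0 (by simp)).eq_deriv _ h2 h1
    rwa [hx0, Matrix.mulVec_mulVec] at this
  · intro h t₀ x hx t ht
    rw [Matrix.mulVec_mulVec, ← h]
    exact output_hasDerivWithinAt hx ht

/-! ### Exponential decay -/

/-- A solution of `ż = λ z + g` with `‖g‖ ≤ H e^{-α (t - t₀)}` and `Re λ < -α` decays at the same
rate `α`: the strict inequality leaves no loss from resonance between `λ` and the forcing. -/
theorem norm_le_of_forced_scalar_ode {E : Type*} [NormedAddCommGroup E] [NormedSpace ℂ E]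
    {z : ℝ → E} {g : ℝ → E} {lam : ℂ} {α H t₀ : ℝ} (hlam : lam.re < -α)
    (hz : ∀ t, t₀ ≤ t → HasDerivWithinAt z (lam • z t + g t) (Set.Ici t₀) t)
    (hg : ∀ t, t₀ ≤ t → ‖g t‖ ≤ H * Real.exp (-α * (t - t₀))) {t : ℝ} (ht : t₀ ≤ t) :
    ‖z t‖ ≤ (‖z t₀‖ + H / (-α - lam.re)) * Real.exp (-α * (t - t₀)) := by
  set a := -α - lam.re with ha
  have hapos : 0 < a := by linarith
  have hH : 0 ≤ H := by
    have := (norm_nonneg _).trans (hg t₀ le_rfl)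
    simpa using this
  let w : ℝ → E := fun s => Complex.exp (-lam * ((s - t₀ : ℝ) : ℂ)) • z s
  have hexp : ∀ s : ℝ, ‖Complex.exp (-lam * ((s - t₀ : ℝ) : ℂ))‖ =
      Real.exp (-lam.re * (s - t₀)) := by
    intro s
    rw [Complex.norm_exp, Complex.re_mul_ofReal, Complex.neg_re]
  have hw : ∀ s, t₀ ≤ s →
      HasDerivWithinAt w (Complex.exp (-lam * ((s - t₀ : ℝ) : ℂ)) • g s) (Set.Ici t₀) s := by
    intro s hs
    have h1 : HasDerivAt (fun s : ℝ => Complex.exp (-lam * ((s - t₀ : ℝ) : ℂ)))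
        (Complex.exp (-lam * ((s - t₀ : ℝ) : ℂ)) * (-lam * ((1 : ℝ) : ℂ))) s :=
      (((hasDerivAt_id s).sub_const t₀).ofReal_comp.const_mul (-lam)).cexp
    refine (h1.hasDerivWithinAt.smul (hz s hs)).congr_deriv ?_
    rw [smul_add, smul_smul]
    simp only [Complex.ofReal_one, mul_one, mul_neg, neg_smul]
    abel
  have hB : ∀ s, HasDerivAt
      (fun s => ‖z t₀‖ + H / a * (Real.exp (a * (s - t₀)) - 1)) (H * Real.exp (a * (s - t₀))) s := by
    intro s
    have h1 := ((((((hasDerivAt_id s).sub_const t₀).const_mul a).exp).sub_const 1).const_mul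
      (H / a)).const_add ‖z t₀‖
    refine h1.congr_deriv ?_
    simp only [id]
    field_simp
  -- With the integrating factor, `w = e^{-λ (t - t₀)} z` has derivative of norm at most
  -- `H e^{a (t - t₀)}`, where `a = -α - Re λ > 0`.
  have hbound := image_norm_le_of_norm_deriv_right_le_deriv_boundary (a := t₀) (b := t)
    (fun s hs => ((hw s hs.1).continuousWithinAt.mono Set.Icc_subset_Ici_self))
    (fun s hs => (hw s hs.1).mono (Set.Ici_subset_Ici.mpr hs.1)) (by simp [w]) hB
    (fun s hs => by
      rw [norm_smul, hexp]
      calc _ ≤ Real.exp (-lam.re * (s - t₀)) * (H * Real.exp (-α * (s - t₀))) := by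
            gcongr; exact hg s hs.1
        _ = _ := by rw [mul_left_comm, ← Real.exp_add, ha]; ring_nf) ⟨ht, le_rfl⟩
  have hzw : ‖z t‖ = Real.exp (lam.re * (t - t₀)) * ‖w t‖ := by
    rw [norm_smul, hexp, ← mul_assoc, ← Real.exp_add]
    simp
  have h1 : Real.exp (lam.re * (t - t₀)) * Real.exp (a * (t - t₀)) =
      Real.exp (-α * (t - t₀)) := by
    rw [← Real.exp_add, ha]; ring_nf
  have h2 : Real.exp (lam.re * (t - t₀)) ≤ Real.exp (-α * (t - t₀)) :=
    Real.exp_le_exp.mpr (mul_le_mul_of_nonneg_right hlam.le (by linarith))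
  have h3 : 0 ≤ H / a := by positivity
  calc ‖z t‖ ≤ Real.exp (lam.re * (t - t₀)) *
        (‖z t₀‖ + H / a * (Real.exp (a * (t - t₀)) - 1)) := by rw [hzw]; gcongr
    _ = Real.exp (lam.re * (t - t₀)) * ‖z t₀‖ + H / a * Real.exp (-α * (t - t₀))
        - H / a * Real.exp (lam.re * (t - t₀)) := by rw [← h1]; ring
    _ ≤ Real.exp (lam.re * (t - t₀)) * ‖z t₀‖ + H / a * Real.exp (-α * (t - t₀)) := by
        have := mul_nonneg h3 (Real.exp_pos (lam.re * (t - t₀))).le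
        linarith
    _ ≤ Real.exp (-α * (t - t₀)) * ‖z t₀‖ + H / a * Real.exp (-α * (t - t₀)) := by gcongr
    _ = _ := by ring

theorem exists_norm_mulVec_le {p : ℕ} (R : Matrix (Fin p) (Fin p) ℂ) :
    ∃ c, 0 ≤ c ∧ ∀ v : Fin p → ℂ, ‖R *ᵥ v‖ ≤ c * ‖v‖ :=
  ⟨‖LinearMap.toContinuousLinearMap R.mulVecLin‖, norm_nonneg _,
    (LinearMap.toContinuousLinearMap R.mulVecLin).le_opNorm⟩

/-- If `∏ (M - λᵢ) R = 0` with `Re λᵢ < -α` and `R` commutes with `M`, then `R y` decays at rate `α`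
for every solution of `ẏ = M y`. Induction on the factors: `z = R y` satisfies
`ż = λ z + (M - λ) R y`, and the forcing term has one factor fewer. -/
theorem exists_decay_of_prod_mul_eq_zero {p : ℕ} (M : Matrix (Fin p) (Fin p) ℂ) {α : ℝ}
    (Λ : Multiset ℂ) (hΛ : ∀ z ∈ Λ, z.re < -α) :
    ∀ R : Matrix (Fin p) (Fin p) ℂ, M * R = R * M →
      Polynomial.aeval M (Λ.map fun z => Polynomial.X - Polynomial.C z).prod * R = 0 →
      ∃ K, 0 ≤ K ∧ ∀ (t₀ : ℝ) (y : ℝ → Fin p → ℂ),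
        (∀ t, t₀ ≤ t → HasDerivWithinAt y (M *ᵥ y t) (Set.Ici t₀) t) →
        ∀ t, t₀ ≤ t → ‖R *ᵥ y t‖ ≤ K * Real.exp (-α * (t - t₀)) * ‖y t₀‖ := by
  induction Λ using Multiset.induction_on with
  | empty =>
    intro R _ h0
    rw [Multiset.map_zero, Multiset.prod_zero, map_one, one_mul] at h0
    exact ⟨0, le_rfl, fun t₀ y _ t _ => by simp [h0]⟩
  | cons lam Λ ih =>
    intro R hMR h0
    obtain ⟨K, hK, hdec⟩ := ih (fun z hz => hΛ z (Multiset.mem_cons_of_mem hz))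
      ((M - algebraMap ℂ _ lam) * R)
      (((Commute.refl M).sub_right (Algebra.commutes lam M).symm).mul_right hMR)
      (by
        rw [← h0, Multiset.map_cons, Multiset.prod_cons, mul_comm (_ - _), map_mul, mul_assoc]
        simp)
    obtain ⟨c, hc, hR⟩ := exists_norm_mulVec_le R
    have hlam := hΛ lam (Multiset.mem_cons_self _ _)
    have hpos : 0 < -α - lam.re := by linarith
    refine ⟨c + K / (-α - lam.re), by positivity, fun t₀ y hy t ht => ?_⟩
    have h1 := norm_le_of_forced_scalar_ode (z := fun t => R *ᵥ y t)
      (g := fun t => ((M - algebraMap ℂ _ lam) * R) *ᵥ y t) (H := K * ‖y t₀‖) hlam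
      (fun s hs => by
        refine (mulVec_hasDerivWithinAt R (hy s hs)).congr_deriv ?_
        rw [Matrix.mulVec_mulVec, ← hMR, Matrix.sub_mul, Matrix.sub_mulVec,
          Algebra.algebraMap_eq_smul_one, Matrix.smul_mul, Matrix.one_mul, Matrix.smul_mulVec]
        abel)
      (fun s hs => (hdec t₀ y hy s hs).trans_eq (by ring)) ht
    refine h1.trans ?_
    have := hR (y t₀)
    calc _ ≤ (c * ‖y t₀‖ + K * ‖y t₀‖ / (-α - lam.re)) * Real.exp (-α * (t - t₀)) := by gcongr
      _ = _ := by ring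

/-- Solutions of `ẏ = M y` decay at every rate `α` for which the eigenvalues of `M` lie to the left
of `-α`. By the Cayley-Hamilton theorem, `R = 1` is admissible in
`exists_decay_of_prod_mul_eq_zero` when the product runs over the eigenvalues of `M`. -/
theorem exists_decay_of_eig {p : ℕ} (M : Matrix (Fin p) (Fin p) ℝ) {α : ℝ}
    (hM : ∀ z ∈ eig M, z.re < -α) :
    ∃ K, ∀ (t₀ : ℝ) (y : ℝ → Fin p → ℝ),
      (∀ t, t₀ ≤ t → HasDerivWithinAt y (M *ᵥ y t) (Set.Ici t₀) t) →
      ∀ t, t₀ ≤ t → ‖y t‖ ≤ K * Real.exp (-α * (t - t₀)) * ‖y t₀‖ := by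
  obtain ⟨K, _, hK⟩ := exists_decay_of_prod_mul_eq_zero (M.map (algebraMap ℝ ℂ)) (eig M) hM 1
    (by simp) (by
      rw [eig, ← (IsAlgClosed.splits _).eq_prod_roots_of_monic (Matrix.charpoly_monic _),
        Matrix.aeval_self_charpoly, Matrix.zero_mul])
  have hnorm : ∀ v : Fin p → ℝ, ‖fun i => (v i : ℂ)‖ = ‖v‖ := by
    intro v
    simp [Pi.norm_def]
  refine ⟨K, fun t₀ y hy t ht => ?_⟩
  have h1 := hK t₀ (fun t i => (y t i : ℂ)) (fun s hs => by
    rw [hasDerivWithinAt_pi]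
    intro i
    refine ((hasDerivWithinAt_pi.mp (hy s hs)) i).ofReal_comp.congr_deriv ?_
    simp [Matrix.mulVec, dotProduct]) t ht
  rwa [Matrix.one_mulVec, hnorm, hnorm] at h1

theorem drivesOutput_of_eig {n m p : ℕ} {A : Matrix (Fin n) (Fin n) ℝ}
    {B : Matrix (Fin n) (Fin m) ℝ} {C : Matrix (Fin p) (Fin n) ℝ}
    {Z : Matrix (Fin m) (Fin p) ℝ} {M : Matrix (Fin p) (Fin p) ℝ}
    (hM : C * (A - B * Z * C) = M * C) : DrivesOutputByPlacing A B C Z (eig M) := by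
  have hode := (output_ode_iff A B C Z M).mpr hM
  have hrate : ∀ α : ℝ, (∀ z ∈ eig M, z.re < -α) → OutputDecaysAtRate A B C Z α := by
    intro α hα
    obtain ⟨K, hK⟩ := exists_decay_of_eig M hα
    exact ⟨K, fun t₀ x hx => hK t₀ _ (hode t₀ x hx)⟩
  refine ⟨⟨M, hode, rfl⟩, fun hneg t₀ x hx => ?_, hrate⟩
  obtain ⟨α, hα, hlt⟩ : ∃ α : ℝ, 0 < α ∧ ∀ z ∈ eig M, z.re < -α := by
    generalize eig M = Λ at hneg
    induction Λ using Multiset.induction_on with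
    | empty => exact ⟨1, one_pos, by simp⟩
    | cons a s ih =>
      obtain ⟨α, hα, h⟩ := ih fun z hz => hneg z (Multiset.mem_cons_of_mem hz)
      have ha := hneg a (Multiset.mem_cons_self _ _)
      refine ⟨min α (-a.re / 2), by apply lt_min hα; linarith, fun z hz => ?_⟩
      rcases Multiset.mem_cons.mp hz with rfl | hz
      · have := min_le_right α (-z.re / 2)
        linarith
      · have := min_le_left α (-a.re / 2)
        have := h z hz
        linarith
  obtain ⟨K, hK⟩ := hrate α hlt
  refine squeeze_zero_norm' (a := fun t => K * Real.exp (-α * (t - t₀)) * ‖C *ᵥ x t₀‖)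
    (Filter.eventually_atTop.mpr ⟨t₀, fun t ht => hK t₀ x hx t ht⟩) ?_
  have h1 : Filter.Tendsto (fun t : ℝ => -α * (t - t₀)) Filter.atTop Filter.atBot :=
    (Filter.tendsto_atTop_add_const_right _ (-t₀) Filter.tendsto_id).const_mul_atTop_of_neg
      (neg_lt_zero.mpr hα)
  simpa using ((Real.tendsto_exp_atBot.comp h1).const_mul K).mul_const ‖C *ᵥ x t₀‖

/-! ### Equivalence of output placement and the rank conditions -/

theorem isPoleSet_replicate (p : ℕ) (r : ℝ) : IsPoleSet p (Multiset.replicate p (r : ℂ)) := by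
  simp [IsPoleSet]

theorem mem_eig_of_vecMul_eq {p : ℕ} {M : Matrix (Fin p) (Fin p) ℝ} {s : ℂ} {w : Fin p → ℂ}
    (hw0 : w ≠ 0) (hw : w ᵥ* M.map (algebraMap ℝ ℂ) = s • w) : s ∈ eig M := by
  rw [eig, Polynomial.mem_roots (Matrix.charpoly_monic _).ne_zero, Polynomial.IsRoot,
    Matrix.eval_charpoly, ← Matrix.exists_vecMul_eq_zero_iff]
  refine ⟨w, hw0, ?_⟩
  rw [Matrix.vecMul_sub, hw, Matrix.scalar_apply, ← Matrix.smul_one_eq_diagonal,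
    Matrix.vecMul_smul, Matrix.vecMul_one, sub_self]

theorem corollary3 {n m p : ℕ} (A : Matrix (Fin n) (Fin n) ℝ) (B : Matrix (Fin n) (Fin m) ℝ)
    (C : Matrix (Fin p) (Fin n) ℝ) (hC : C.rank = p) :
    (CanDriveOutputByPlacement A B C ↔ (OutputRankCondition A C ∧ PencilRankCondition A B C)) ∧
    (OutputRankCondition A C → PencilRankCondition A B C →
      ∀ Cinv : Matrix (Fin n) (Fin p) ℝ, C * Cinv * C = C →
      ∀ Λ : Multiset ℂ, IsPoleSet p Λ →
        (∃ Z : Matrix (Fin m) (Fin p) ℝ, eig (C * A * Cinv - C * B * Z) = Λ) ∧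
        (∀ Z : Matrix (Fin m) (Fin p) ℝ,
          (eig (C * A * Cinv - C * B * Z) = Λ ↔ DrivesOutputByPlacing A B C Z Λ) ∧
          (eig (C * A * Cinv - C * B * Z) = Λ → Λ ≤ eig (A - B * Z * C)))) := by
  have hclosed : ∀ {F : Matrix (Fin p) (Fin p) ℝ}, C * A = F * C → ∀ Z : Matrix (Fin m) (Fin p) ℝ,
      C * (A - B * Z * C) = (F - C * B * Z) * C := by
    intro F hF Z
    simp only [Matrix.mul_sub, Matrix.sub_mul, hF, Matrix.mul_assoc]
  have hplace : ∀ {F : Matrix (Fin p) (Fin p) ℝ}, C * A = F * C → PencilRankCondition A B C →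
      ∀ Λ : Multiset ℂ, IsPoleSet p Λ → ∃ Z : Matrix (Fin m) (Fin p) ℝ, eig (F - C * B * Z) = Λ :=
    fun hF hpen Λ hΛ =>
      exists_eig_sub_mul_eq _ _ ((pencilRankCondition_iff A B C hC _ hF).mp hpen) hΛ
  refine ⟨⟨fun hdrive => ?_, fun ⟨hout, hpen⟩ => ?_⟩, fun hout hpen Cinv hinv Λ hΛ => ?_⟩
  · obtain ⟨Z₀, ⟨M₀, hode₀, -⟩, -⟩ := hdrive.1 _ (isPoleSet_replicate p 0)
    have hM₀ := (output_ode_iff A B C Z₀ M₀).mp hode₀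
    have hF : C * A = (M₀ + C * B * Z₀) * C := by
      rw [Matrix.add_mul, ← hM₀, Matrix.mul_sub]
      simp only [Matrix.mul_assoc, sub_add_cancel]
    refine ⟨(outputRankCondition_iff A C hC).mpr ⟨_, hF⟩,
      (pencilRankCondition_iff A B C hC _ hF).mpr fun s w hw hwG => ?_⟩
    by_contra hw0
    -- An uncontrollable eigenvalue `s` survives every feedback, so poles away from `s` cannot be
    -- placed.
    obtain ⟨Z, ⟨M, hode, heig⟩, -⟩ := hdrive.1 _ (isPoleSet_replicate p (s.re + 1))
    have hM := (output_ode_iff A B C Z M).mp hode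
    have hMF : M = M₀ + C * B * Z₀ - C * B * Z :=
      eq_of_mul_right_eq hC (hM.symm.trans (hclosed hF Z))
    have hs : s ∈ eig M := by
      refine mem_eig_of_vecMul_eq hw0 ?_
      rw [hMF, Matrix.map_sub _ (map_sub _), Matrix.map_mul, Matrix.vecMul_sub,
        ← Matrix.vecMul_vecMul, hwG, Matrix.zero_vecMul, sub_zero, hw]
    rw [heig] at hs
    have := congrArg Complex.re (Multiset.eq_of_mem_replicate hs)
    simp at this
  · obtain ⟨F, hF⟩ := (outputRankCondition_iff A C hC).mp hout
    refine ⟨fun Λ hΛ => ?_, fun α hα => ?_⟩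
    · obtain ⟨Z, rfl⟩ := hplace hF hpen Λ hΛ
      exact ⟨Z, drivesOutput_of_eig (hclosed hF Z)⟩
    · have hΛ := isPoleSet_replicate p (-α - 1)
      obtain ⟨Z, hZ⟩ := hplace hF hpen _ hΛ
      have hd := drivesOutput_of_eig (hclosed hF Z)
      rw [hZ] at hd
      refine ⟨Z, _, hΛ, hd, hd.2.1 fun z hz => ?_, hd.2.2 α fun z hz => ?_⟩ <;>
      · rw [Multiset.eq_of_mem_replicate hz, Complex.ofReal_re]
        linarith
  · obtain ⟨F, hF⟩ := (outputRankCondition_iff A C hC).mp hout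
    have hone : C * Cinv = 1 := eq_of_mul_right_eq hC (by rw [hinv, Matrix.one_mul])
    have hFC : C * A * Cinv = F := by rw [hF, Matrix.mul_assoc, hone, Matrix.mul_one]
    rw [hFC]
    refine ⟨hplace hF hpen Λ hΛ, fun Z => ⟨⟨?_, ?_⟩, ?_⟩⟩
    · rintro rfl
      exact drivesOutput_of_eig (hclosed hF Z)
    · rintro ⟨⟨M, hode, rfl⟩, -⟩
      rw [eq_of_mul_right_eq hC
        (((output_ode_iff A B C Z M).mp hode).symm.trans (hclosed hF Z))]
    · rintro rfl
      exact eig_le_eig_of_mul_eq hC (hclosed hF Z)
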